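/- Let $n\ge 3$. Let $\widetilde\Delta$ be a finite disjoint union of oriented Euclidean $n$-simplices, and let $\Phi$ be a family of orientation-reversing affine isomorphisms (face pairings) that pairs the facets of $\widetilde\Delta$ (no facet being paired with itself). Let $\widehat M=\widetilde\Delta/\Phi$ be the quotient pseudo-manifold, $p\colon\widetilde\Delta\to\widehat M$ the quotient map, and $\widehat M^{(j)}$ the image of the $j$-skeleton. Call a point $y\in\widehat M\setminus\widehat M^{(n-3)}$ regular if $p$ is injective near each $a\in p^{-1}(y)$ on the open face of $\widetilde\Delta$ that contains $a$. (If no $(n-2)$-simplex is glued to itself by a nontrivial symmetry, which is automatic for $n=3$, then all points of $\widehat M\setminus\widehat M^{(n-3)}$ are regular; for $n=3$ they are all points other than the vertices.) The degree of an $(n-2)$-singlex $\tau$ (the image of an $(n-2)$-simplex) is the number of sheets of $p\colon p^{-1}(\tau)\to\tau$, i.e. the number of points of $p^{-1}(y)$ for $y$ regular in the interior of $\tau$. The triangulation is even if every $(n-2)$-singlex has even degree. Let $1<k\le\frac{n+1}{2}$. A $(k,n-k+1)$-normal disc type $\nu$ in an $n$-simplex $\sigma$ is an unordered partition of the vertices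 of $\sigma$ into a set of size $k$ and a set of size $n-k+1$; the standard disc $\overline\nu$ is the convex hull of the midpoints of the edges of $\sigma$ that join the two sets. For a facet $\tau$ of $\sigma$ with face pairing $\varphi_\tau\colon\tau\to\tau'$, $\tau'$ a facet of $\sigma'$, the perspectivity $p_\tau$ is the bijection from the vertices of $\sigma$ to those of $\sigma'$ that extends $\varphi_\tau$ and sends the vertex opposite to $\tau$ to the vertex opposite to $\tau'$. The $(k,n-k+1)$-hypersurface $H$ is obtained from the disjoint union of all the discs $\overline\nu$, one for each $n$-simplex $\sigma$ of $\widetilde\Delta$ and each $(k,n-k+1)$-normal disc type $\nu$ in $\sigma$, by gluing, for each facet $\tau$ of $\sigma$, the face $\overline\nu\cap\tau$ of $\overline\nu$ to the face $\overline{p_\tau(\nu)}\cap\tau'$ of $\overline{p_\tau(\nu)}$ by $\varphi_\tau$. The inclusions of the discs into the simplices induce a map $f\colon H\to\widehat M$. Say that the $(k,n-k+1)$-hypersurface is an immersion (without branching) if each $h\in H$ with $f(h)$ regular has a neighbourhood on which $f$ is injective. Then the $(k,n-k+1)$-hypersurface is an immersion if and only if the triangulation is even. -/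

import Mathlib

open Topology

noncomputable section

namespace PseudoManifold

/-- The standard Euclidean `n`-simplex, in barycentric coordinates; its corners are `Fin (n + 1)`. -/
abbrev Simplex (n : ℕ) : Type := stdSimplex ℝ (Fin (n + 1))

/-- The corners of the smallest face of the simplex that contains `x`. -/
def support {n : ℕ} (x : Simplex n) : Finset (Fin (n + 1)) :=
  Finset.univ.filter fun j => (x : Fin (n + 1) → ℝ) j ≠ 0

/-- A (singular) triangulation: oriented `n`-simplices indexed by `S`, with face pairings.
The facet of `σ` opposite to the corner `i` is written `(σ, i)`. Its face pairing is an affine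
isomorphism onto a facet `(σ', i')`, that is, a bijection from the corners other than `i` to the
corners other than `i'`. Such data are the same as `σ' = nbr σ i` together with the permutation
`perm σ i` that extends this bijection by `i ↦ i'` (the perspectivity of the facet). -/
structure Triangulation (n : ℕ) (S : Type*) where
  /-- the simplex on the other side of the facet `(σ, i)` -/
  nbr : S → Fin (n + 1) → S
  /-- the face pairing of the facet `(σ, i)`, extended by opposite corner to opposite corner -/
  perm : S → Fin (n + 1) → Equiv.Perm (Fin (n + 1))
  /-- the orientation of each simplex, relative to the standard order of its corners -/
  orient : S → ℤˣ
  /-- the inverse of a face pairing is a face pairing -/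
  nbr_nbr : ∀ σ i, nbr (nbr σ i) (perm σ i i) = σ
  perm_nbr : ∀ σ i, perm (nbr σ i) (perm σ i i) = (perm σ i)⁻¹
  /-- no facet is paired with itself -/
  ne_self : ∀ σ i, (nbr σ i, perm σ i i) ≠ (σ, i)
  /-- face pairings reverse the induced orientations; as the extension sends opposite corner to
  opposite corner, this says that the extension reverses the orientations of the simplices -/
  orient_reversing : ∀ σ i, Equiv.Perm.sign (perm σ i) * orient σ * orient (nbr σ i) = -1

namespace Triangulation

variable {n : ℕ} {S : Type*} (T : Triangulation n S)

/-- The disjoint union of the simplices. -/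
abbrev Delta (_T : Triangulation n S) : Type _ := Σ _ : S, Simplex n

/-- `Glue a b`: the point `a` lies in a facet `(σ, i)`, and its face pairing sends `a` to `b`. -/
def Glue (a b : T.Delta) : Prop :=
  ∃ i : Fin (n + 1), a.2 i = 0 ∧ b.1 = T.nbr a.1 i ∧ ∀ j, b.2 (T.perm a.1 i j) = a.2 j

/-- The closed pseudo-manifold: the quotient of the disjoint union of the simplices by the
equivalence relation generated by the face pairings, with the quotient topology. -/
def Space : Type _ := Quot T.Glue

instance : TopologicalSpace T.Space := inferInstanceAs (TopologicalSpace (Quot T.Glue))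

/-- The quotient map. -/
def proj (a : T.Delta) : T.Space := Quot.mk T.Glue a

/-- The image of the `d`-skeleton: the union of all `j`-singlices with `j ≤ d`. -/
def skeleton (d : ℕ) : Set T.Space :=
  T.proj '' {a | (support a.2).card ≤ d + 1}

/-- The quotient map is injective near `a` on the open face of the simplex that contains `a`:
`a` is not fixed by a nontrivial symmetry by which that face is glued to itself. -/
def IsFree (a : T.Delta) : Prop :=
  ∃ V ∈ 𝓝 a.2, ∀ y ∈ V, ∀ z ∈ V, support y = support a.2 → support z = support a.2 →
    T.proj ⟨a.1, y⟩ = T.proj ⟨a.1, z⟩ → y = z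

/-- The regular points: those outside the `(n - 3)`-skeleton that are not fixed by a nontrivial
self-gluing of a face. Only faces of dimension `n - 2` matter here; if none of them is glued to
itself by a nontrivial symmetry, these are all points outside the `(n - 3)`-skeleton. -/
def IsRegular (y : T.Space) : Prop :=
  y ∉ T.skeleton (n - 3) ∧ ∀ a, T.proj a = y → T.IsFree a

/-- The number of points of the disjoint union of simplices over a point. -/
def fibreCard (y : T.Space) : ℕ := (T.proj ⁻¹' {y}).ncard

/-- The triangulation is even: every `(n - 2)`-singlex `τ` has even degree. The degree of `τ` is
the degree (the number of sheets) of the restriction of the quotient map over `τ`, that is, the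
number of points over a regular point in the interior of `τ`. The interior of an `(n - 2)`-simplex
consists of the points with exactly `n - 1` nonzero coordinates. -/
def IsEven : Prop :=
  ∀ a : T.Delta, (support a.2).card = n - 1 → T.IsRegular (T.proj a) →
    Even (T.fibreCard (T.proj a))

end Triangulation

/-- A `(k, n - k + 1)`-normal disc type: an unordered partition of the corners of an `n`-simplex
into a set with `k` elements and its complement. -/
def DiscType (n k : ℕ) : Type :=
  {P : Sym2 (Finset (Fin (n + 1))) // ∃ A : Finset (Fin (n + 1)), A.card = k ∧ P = s(A, Aᶜ)}

/-- The image of a disc type under a permutation of the corners. -/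
def DiscType.map {n k : ℕ} (g : Equiv.Perm (Fin (n + 1))) (ν : DiscType n k) : DiscType n k :=
  ⟨Sym2.map (Finset.map g.toEmbedding) ν.1, by
    obtain ⟨A, hA, h⟩ := ν.2
    refine ⟨A.map g.toEmbedding, by simpa using hA, ?_⟩
    rw [h, Sym2.map_mk]
    congr 2
    ext j
    simp⟩

/-- The corner `i` as a vector of barycentric coordinates. -/
abbrev corner {n : ℕ} (i : Fin (n + 1)) : Fin (n + 1) → ℝ := Pi.single i 1

/-- The standard normal disc of type `ν`: the convex hull of the midpoints of the edges that
join the two sets of the partition. -/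
def disc {n k : ℕ} (ν : DiscType n k) : Set (Simplex n) :=
  {x | (x : Fin (n + 1) → ℝ) ∈ convexHull ℝ {m : Fin (n + 1) → ℝ |
    ∃ A ∈ ν.1, ∃ i ∈ A, ∃ j ∉ A, m = midpoint ℝ (corner i) (corner j)}}

/-- The standard normal disc is the section of the simplex by a hyperplane. -/
theorem mem_disc_iff {n k : ℕ} (ν : DiscType n k) (x : Simplex n) :
    x ∈ disc ν ↔ ∀ A ∈ ν.1, ∑ i ∈ A, (x : Fin (n + 1) → ℝ) i = 1 / 2 := by
  classical
  obtain ⟨A₀, hA₀, hν⟩ := ν.2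
  have hsum : ∀ A : Finset (Fin (n + 1)),
      ∑ i ∈ A, (x : Fin (n + 1) → ℝ) i + ∑ i ∈ Aᶜ, (x : Fin (n + 1) → ℝ) i = 1 := fun A => by
    rw [Finset.sum_add_sum_compl]; exact x.2.2
  have hmem : (∀ A ∈ s(A₀, A₀ᶜ), ∑ i ∈ A, (x : Fin (n + 1) → ℝ) i = 1 / 2) ↔
      ∑ i ∈ A₀, (x : Fin (n + 1) → ℝ) i = 1 / 2 := by
    have := hsum A₀
    simp only [Sym2.mem_iff, forall_eq_or_imp, forall_eq]
    constructor
    · exact fun h => h.1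
    · exact fun h => ⟨h, by linarith⟩
  unfold disc
  rw [hν, hmem, Set.mem_ofPred_eq]
  constructor
  · intro hx
    have hconv : Convex ℝ {f : Fin (n + 1) → ℝ | ∑ i ∈ A₀, f i = 1 / 2} := by
      intro f hf g hg a b _ _ hab
      simp only [Set.mem_ofPred_eq, Pi.add_apply, Pi.smul_apply, smul_eq_mul,
        Finset.sum_add_distrib, ← Finset.mul_sum] at hf hg ⊢
      rw [hf, hg, ← add_mul, hab, one_mul]
    refine convexHull_min ?_ hconv hx
    rintro m ⟨A, hA, i, hi, j, hj, rfl⟩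
    simp only [Set.mem_ofPred_eq, midpoint_eq_smul_add, Pi.smul_apply, Pi.add_apply,
      smul_eq_mul, ← Finset.mul_sum, Finset.sum_add_distrib]
    rcases Sym2.mem_iff.1 hA with rfl | rfl
    · simp [hi, hj]
    · simp at hi hj
      simp [hi, hj]
  · intro hx
    have hx' : ∑ i ∈ A₀ᶜ, (x : Fin (n + 1) → ℝ) i = 1 / 2 := by have := hsum A₀; linarith
    have key : (x : Fin (n + 1) → ℝ) = ∑ p ∈ A₀ ×ˢ A₀ᶜ,
        (4 * ((x : Fin (n + 1) → ℝ) p.1 * (x : Fin (n + 1) → ℝ) p.2)) •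
          midpoint ℝ (corner p.1) (corner p.2) := by
      ext l
      rw [Finset.sum_apply, Finset.sum_product]
      have h1 : ∀ i j : Fin (n + 1), ((4 * ((x : Fin (n + 1) → ℝ) i * (x : Fin (n + 1) → ℝ) j)) •
          midpoint ℝ (corner i) (corner j)) l =
          2 * ((x : Fin (n + 1) → ℝ) j * (Pi.single i ((x : Fin (n + 1) → ℝ) i) : Fin (n + 1) → ℝ) l) +
          2 * ((x : Fin (n + 1) → ℝ) i * (Pi.single j ((x : Fin (n + 1) → ℝ) j) : Fin (n + 1) → ℝ) l) := by
        intro i j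
        simp only [midpoint_eq_smul_add, Pi.smul_apply, Pi.add_apply, smul_eq_mul, Pi.single_apply]
        rw [invOf_eq_inv]
        split_ifs <;> ring
      simp only [h1, Finset.sum_add_distrib, ← Finset.mul_sum, ← Finset.sum_mul, hx, hx',
        Finset.sum_pi_single]
      by_cases hl : l ∈ A₀ <;> simp [hl]
    rw [key]
    refine (convex_convexHull ℝ _).sum_mem ?_ ?_ ?_
    · intro p _
      have h1 := x.2.1 p.1
      have h2 := x.2.1 p.2
      positivity
    · rw [Finset.sum_product]
      simp only [← Finset.mul_sum, ← Finset.sum_mul, hx, hx']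
      norm_num
    · rintro ⟨i, j⟩ hp
      rw [Finset.mem_product, Finset.mem_compl] at hp
      exact subset_convexHull ℝ _ ⟨A₀, by simp, i, hp.1, j, hp.2, rfl⟩

namespace Triangulation

variable {n : ℕ} {S : Type*} (T : Triangulation n S)

/-- The disjoint union of normal discs, one of each type `(k, n - k + 1)` in each simplex. -/
abbrev Discs (_T : Triangulation n S) (k : ℕ) : Type _ :=
  Σ p : S × DiscType n k, disc p.2

/-- The gluing of the discs. If the point `a` of the disc of type `ν` in `σ` lies in the facet
`(σ, i)`, it is identified with its image under the face pairing, in the disc of type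
`perm σ i (ν)` of the adjacent simplex. -/
def DiscGlue (k : ℕ) (a b : T.Discs k) : Prop :=
  ∃ i : Fin (n + 1), a.2.1 i = 0 ∧
    b.1 = (T.nbr a.1.1 i, a.1.2.map (T.perm a.1.1 i)) ∧
    ∀ j, b.2.1 (T.perm a.1.1 i j) = a.2.1 j

/-- The `(k, n - k + 1)`-hypersurface as an abstract complex, with the quotient topology. -/
def Hypersurface (k : ℕ) : Type _ := Quot (T.DiscGlue k)

instance (k : ℕ) : TopologicalSpace (T.Hypersurface k) :=
  inferInstanceAs (TopologicalSpace (Quot (T.DiscGlue k)))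

/-- The natural map of the `(k, n - k + 1)`-hypersurface to the pseudo-manifold, induced by the
inclusions of the discs into the simplices. -/
def hypersurfaceMap (k : ℕ) : T.Hypersurface k → T.Space :=
  Quot.lift (fun a => T.proj ⟨a.1.1, a.2.1⟩) (by
    rintro a b ⟨i, hi, hb, h⟩
    exact Quot.sound ⟨i, hi, congrArg Prod.fst hb, h⟩)

/-- The `(k, n - k + 1)`-hypersurface is an immersion (without branching): its natural map is
locally injective at every point that lies over a regular point of the pseudo-manifold. -/
def HypersurfaceIsImmersion (k : ℕ) : Prop :=
  ∀ h : T.Hypersurface k, T.IsRegular (T.hypersurfaceMap k h) →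
    ∃ U ∈ 𝓝 h, Set.InjOn (T.hypersurfaceMap k) U

end Triangulation

end PseudoManifold

end

/-!
Follow a simplex together with a labelling of its corners through the face pairings. The sheets over
the interior of a codimension-two face with opposite corners `i` and `j` are met in turn on a walk
around that face, on which each face pairing exchanges the roles of `i` and `j`. As face pairings
reverse orientations, the walk cannot return to a regular point too early with these two corners
exchanged, and so the degree is odd exactly if the face pairings alone link the simplex to itself
with the labels `i` and `j` exchanged.

In that case choose a disc type that separates `i` from `j` and is not preserved by their
transposition, and a regular point `x` of the disc in the interior of the face. The disc and its
transpose are glued at `x`, but arbitrarily near `x` they share an interior point of the simplex,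
with equal coordinates at `i` and `j`, and there they are different sheets. A point with different
nonzero coordinates is regular; for `n = 3` both nonzero coordinates are `1 / 2`, but there all
interior points of edges are regular, by the dihedral symmetry of the walk. Conversely, if face
pairings never link a simplex to a nontrivial relabelling of itself that fixes a regular point, then
the discs around a point of the hypersurface over it form an embedded patch.
-/

namespace PseudoManifold

variable {n k : ℕ} {i j p q : Fin (n + 1)}

/-- The simplicial automorphism of the standard simplex that moves each corner `i` to `w i`. -/
def Simplex.permute (w : Equiv.Perm (Fin (n + 1))) (x : Simplex n) : Simplex n :=
  ⟨fun l => x (w.symm l), fun l => x.2.1 (w.symm l), by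
    rw [← x.2.2]
    exact Equiv.sum_comp w.symm (x : Fin (n + 1) → ℝ)⟩

@[simp]
theorem Simplex.permute_apply (w : Equiv.Perm (Fin (n + 1))) (x : Simplex n) (l : Fin (n + 1)) :
    x.permute w l = x (w.symm l) := rfl

@[simp]
theorem Simplex.permute_one (x : Simplex n) : x.permute 1 = x := rfl

theorem Simplex.permute_mul (g h : Equiv.Perm (Fin (n + 1))) (x : Simplex n) :
    x.permute (g * h) = (x.permute h).permute g := rfl

theorem Simplex.eq_permute_iff {w : Equiv.Perm (Fin (n + 1))} {x y : Simplex n} :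
    y = x.permute w ↔ ∀ l, y (w l) = x l := by
  rw [stdSimplex.ext_iff, funext_iff, ← w.forall_congr_right]
  simp

@[simp]
theorem Simplex.permute_inv_permute (w : Equiv.Perm (Fin (n + 1))) (x : Simplex n) :
    (x.permute w).permute w⁻¹ = x := by
  rw [← Simplex.permute_mul, inv_mul_cancel, Simplex.permute_one]

theorem Simplex.permute_bijective (w : Equiv.Perm (Fin (n + 1))) :
    Function.Bijective (Simplex.permute w) :=
  Function.bijective_iff_has_inverse.2
    ⟨Simplex.permute w⁻¹, permute_inv_permute w, fun x => by
      simpa using permute_inv_permute w⁻¹ x⟩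

theorem Simplex.continuous_coord (l : Fin (n + 1)) : Continuous fun x : Simplex n => x l :=
  (continuous_apply l).comp continuous_subtype_val

theorem Simplex.continuous_permute (w : Equiv.Perm (Fin (n + 1))) :
    Continuous (Simplex.permute w) :=
  continuous_induced_rng.2 <|
    continuous_pi fun l => continuous_coord (w.symm l)

/-- The corners opposite to the facets that contain `x`. -/
def zeros (x : Simplex n) : Set (Fin (n + 1)) := {l | x l = 0}

theorem mem_zeros {x : Simplex n} {l : Fin (n + 1)} : l ∈ zeros x ↔ x l = 0 := Iff.rfl

theorem preimage_zeros_permute (w : Equiv.Perm (Fin (n + 1))) (x : Simplex n) :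
    w ⁻¹' zeros (x.permute w) = zeros x := by
  ext l
  simp [mem_zeros]

theorem mem_support {x : Simplex n} {l : Fin (n + 1)} : l ∈ support x ↔ x l ≠ 0 := by
  simp only [support, Finset.mem_filter, Finset.mem_univ, true_and]

theorem zeros_eq_coe_compl_support (x : Simplex n) : zeros x = ((support x)ᶜ : Finset _) := by
  ext l
  simp [mem_support, mem_zeros]

theorem support_eq_support_iff {x y : Simplex n} : support x = support y ↔ zeros x = zeros y := by
  rw [zeros_eq_coe_compl_support, zeros_eq_coe_compl_support, Finset.coe_inj, compl_inj_iff]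

theorem zeros_permute_eq_iff {w : Equiv.Perm (Fin (n + 1))} {x y : Simplex n} :
    zeros (x.permute w) = zeros (y.permute w) ↔ zeros x = zeros y := by
  rw [← preimage_zeros_permute w x, ← preimage_zeros_permute w y,
    (Set.preimage_injective.2 w.surjective).eq_iff]

theorem ncard_zeros_add_card_support (x : Simplex n) :
    (zeros x).ncard + (support x).card = n + 1 := by
  rw [zeros_eq_coe_compl_support, Set.ncard_coe_finset, Finset.card_compl_add_card,
    Fintype.card_fin]

theorem ncard_zeros_permute (w : Equiv.Perm (Fin (n + 1))) (x : Simplex n) :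
    (zeros (x.permute w)).ncard = (zeros x).ncard := by
  rw [← preimage_zeros_permute w x, Set.ncard_preimage_of_injective_subset_range w.injective]
  simp

theorem DiscType.map_one (ν : DiscType n k) : ν.map 1 = ν := by
  apply Subtype.ext
  change Sym2.map (Finset.map (Equiv.refl _).toEmbedding) ν.1 = ν.1
  have : Finset.map (Equiv.refl (Fin (n + 1))).toEmbedding = id := by ext A; simp
  rw [this, Sym2.map_id, id]

theorem DiscType.map_mul (g h : Equiv.Perm (Fin (n + 1))) (ν : DiscType n k) :
    ν.map (g * h) = (ν.map h).map g := by
  apply Subtype.ext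
  simp only [DiscType.map, Sym2.map_map]
  congr 1
  ext A l
  simp only [Function.comp_apply, Finset.map_map]
  rfl

theorem DiscType.map_injective (w : Equiv.Perm (Fin (n + 1))) :
    Function.Injective (DiscType.map w : DiscType n k → DiscType n k) :=
  Function.LeftInverse.injective (g := DiscType.map w⁻¹) fun ν => by
    rw [← DiscType.map_mul, inv_mul_cancel, DiscType.map_one]

theorem permute_mem_disc {ν : DiscType n k} {x : Simplex n} (hx : x ∈ disc ν)
    (w : Equiv.Perm (Fin (n + 1))) : x.permute w ∈ disc (ν.map w) := by
  rw [mem_disc_iff] at hx ⊢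
  intro A hA
  obtain ⟨B, hB, rfl⟩ := Sym2.mem_map.1 hA
  simpa [Finset.sum_map] using hx B hB

theorem eq_of_quot_mk_eq {α : Type*} {r : α → α → Prop} (hr : ∀ a b, r a b → r b a) {P : α → Prop}
    (hP : ∀ a b, r a b → P a → P b) {a b : α} (h : Quot.mk r a = Quot.mk r b) (ha : P a) : P b :=
  (congrArg (Quot.lift P fun a b hab => propext ⟨hP a b hab, hP b a (hr a b hab)⟩) h).mp ha

/-! ### Frames -/

/-- A frame: a simplex with its corners labelled by `Fin (n + 1)`, the label `c` being attached to
the corner `f.2 c` of the simplex `f.1`. Face pairings carry frames to frames, so that a sequence of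
face pairings is tracked without composing permutations by hand. -/
abbrev Frame (n : ℕ) (S : Type*) : Type _ := S × Equiv.Perm (Fin (n + 1))

/-- The relabelling of frames that attaches the label `c` to the corner that had the label `u c`. -/
def relabel {S : Type*} (u : Equiv.Perm (Fin (n + 1))) : Equiv.Perm (Frame n S) :=
  (Equiv.refl S).prodCongr (Equiv.mulRight u)

namespace Triangulation

variable {S : Type*} {T : Triangulation n S} {f g h : Frame n S} {x y : Simplex n}
  {Z Z' : Set (Fin (n + 1))}

theorem relabel_one (f : Frame n S) : relabel 1 f = f := rfl

theorem relabel_relabel (u v : Equiv.Perm (Fin (n + 1))) (f : Frame n S) :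
    relabel u (relabel v f) = relabel (v * u) f := rfl

theorem relabel_eq_self_iff {u : Equiv.Perm (Fin (n + 1))} : relabel u f = f ↔ u = 1 := by
  simp [relabel, Prod.ext_iff]

variable (T) in
/-- The face pairing across the facet opposite to the corner labelled `c`, acting on frames. -/
def cross (c : Fin (n + 1)) : Equiv.Perm (Frame n S) :=
  Function.Involutive.toPerm
    (fun f => (T.nbr f.1 (f.2 c), T.perm f.1 (f.2 c) * f.2)) fun f => by
      simp [T.nbr_nbr, T.perm_nbr]

@[simp]
theorem cross_cross (c : Fin (n + 1)) (f : Frame n S) : T.cross c (T.cross c f) = f :=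
  Function.Involutive.toPerm_involutive _ f

theorem cross_apply (c : Fin (n + 1)) (f : Frame n S) :
    T.cross c f = (T.nbr f.1 (f.2 c), T.perm f.1 (f.2 c) * f.2) := rfl

theorem cross_relabel (c : Fin (n + 1)) (u : Equiv.Perm (Fin (n + 1))) (f : Frame n S) :
    T.cross c (relabel u f) = relabel u (T.cross (u c) f) := rfl

theorem cross_ne_relabel {c : Fin (n + 1)} {u : Equiv.Perm (Fin (n + 1))} (hu : u c = c)
    (f : Frame n S) : T.cross c f ≠ relabel u f := by
  intro h
  obtain ⟨hnbr, hperm⟩ := Prod.ext_iff.1 h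
  refine T.ne_self f.1 (f.2 c) (Prod.ext hnbr ?_)
  simpa [cross_apply, relabel, hu] using DFunLike.congr_fun hperm c

variable (T) in
/-- Two frames are linked by `Z` if a sequence of face pairings, each of them across a facet
opposite to a corner with a label in `Z`, leads from one to the other. -/
def Linked (Z : Set (Fin (n + 1))) : Frame n S → Frame n S → Prop :=
  Relation.ReflTransGen fun f g => ∃ c ∈ Z, g = T.cross c f

theorem Linked.symm (hfg : T.Linked Z f g) : T.Linked Z g f := by
  induction hfg with
  | refl => exact .refl
  | @tail g _ _ h ih =>
    obtain ⟨c, hc, rfl⟩ := h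
    exact .head ⟨c, hc, (cross_cross c g).symm⟩ ih

theorem Linked.trans (hfg : T.Linked Z f g) (hgh : T.Linked Z g h) : T.Linked Z f h :=
  Relation.ReflTransGen.trans hfg hgh

theorem Linked.mono (hZ : Z ⊆ Z') (hfg : T.Linked Z f g) : T.Linked Z' f g :=
  Relation.ReflTransGen.mono (fun _ _ ⟨c, hc, hg⟩ => ⟨c, hZ hc, hg⟩) _ _ hfg

theorem Linked.map_relabel (u : Equiv.Perm (Fin (n + 1))) (hfg : T.Linked Z f g) :
    T.Linked (u ⁻¹' Z) (relabel u f) (relabel u g) :=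
  Relation.ReflTransGen.lift (relabel u) (fun f g ⟨c, hc, hg⟩ =>
    ⟨u.symm c, by simpa using hc, by rw [cross_relabel, u.apply_symm_apply, hg]⟩) _ _ hfg

theorem linked_empty_iff : T.Linked ∅ f g ↔ f = g := by
  refine ⟨fun hfg => ?_, fun hfg => hfg ▸ Relation.ReflTransGen.refl⟩
  induction hfg with
  | refl => rfl
  | tail _ h _ => simp at h

variable (T) in
/-- The point with coordinate `x c` at the corner labelled `c` of the frame. -/
def point (f : Frame n S) (x : Simplex n) : T.Delta := ⟨f.1, x.permute f.2⟩

theorem point_one (a : T.Delta) : T.point (a.1, 1) a.2 = a := rfl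

theorem point_relabel (u : Equiv.Perm (Fin (n + 1))) (f : Frame n S) (x : Simplex n) :
    T.point (relabel u f) x = T.point f (x.permute u) := rfl

theorem point_eq_point_iff :
    T.point f x = T.point g y ↔ ∃ u, g = relabel u f ∧ x = y.permute u := by
  constructor
  · obtain ⟨σ, w⟩ := f
    obtain ⟨τ, w'⟩ := g
    intro h
    obtain ⟨rfl, h⟩ := Sigma.mk.inj_iff.1 h
    refine ⟨w⁻¹ * w', Prod.ext rfl (mul_inv_cancel_left w w').symm, ?_⟩
    rw [Simplex.permute_mul, ← eq_of_heq h, ← Simplex.permute_mul, inv_mul_cancel,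
      Simplex.permute_one]
  · rintro ⟨u, rfl, rfl⟩
    rfl

theorem glue_iff {σ : S} {x : Simplex n} {b : T.Delta} :
    T.Glue ⟨σ, x⟩ b ↔ ∃ l ∈ zeros x, b = ⟨T.nbr σ l, x.permute (T.perm σ l)⟩ := by
  obtain ⟨τ, y⟩ := b
  refine exists_congr fun l => and_congr_right fun _ => ?_
  rw [← Simplex.eq_permute_iff]
  constructor
  · rintro ⟨rfl, rfl⟩
    rfl
  · rintro ⟨⟩
    exact ⟨rfl, rfl⟩

theorem glue_point_iff {b : T.Delta} :
    T.Glue (T.point f x) b ↔ ∃ c ∈ zeros x, b = T.point (T.cross c f) x := by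
  rw [point, glue_iff, f.2.symm.exists_congr_left]
  simp only [Equiv.symm_symm, mem_zeros, Simplex.permute_apply, Equiv.symm_apply_apply]
  rfl

theorem glue_symm (a b : T.Delta) (hab : T.Glue a b) : T.Glue b a := by
  rw [← point_one a, glue_point_iff] at hab
  obtain ⟨c, hc, rfl⟩ := hab
  exact glue_point_iff.2 ⟨c, hc, by rw [cross_cross, point_one]⟩

theorem Linked.proj_point_eq (hfg : T.Linked (zeros x) f g) :
    T.proj (T.point f x) = T.proj (T.point g x) := by
  induction hfg with
  | refl => rfl
  | tail _ h ih =>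
    obtain ⟨c, hc, rfl⟩ := h
    exact ih.trans (Quot.sound (glue_point_iff.2 ⟨c, hc, rfl⟩))

theorem proj_point_eq_iff {a : T.Delta} :
    T.proj (T.point f x) = T.proj a ↔ ∃ g, T.Linked (zeros x) f g ∧ a = T.point g x := by
  constructor
  · intro h
    refine eq_of_quot_mk_eq (P := fun b => ∃ g, T.Linked (zeros x) f g ∧ b = T.point g x)
      glue_symm ?_ h ⟨f, .refl, rfl⟩
    rintro _ b hb ⟨g, hg, rfl⟩
    obtain ⟨c, hc, rfl⟩ := glue_point_iff.1 hb
    exact ⟨_, hg.tail ⟨c, hc, rfl⟩, rfl⟩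
  · rintro ⟨g, hg, rfl⟩
    exact hg.proj_point_eq

theorem proj_point_eq_proj_point_iff :
    T.proj (T.point f x) = T.proj (T.point g y) ↔
      ∃ u, T.Linked (zeros x) f (relabel u g) ∧ y = x.permute u := by
  simp only [proj_point_eq_iff, point_eq_point_iff]
  constructor
  · rintro ⟨_, h, u, rfl, hy⟩
    exact ⟨u, h, hy⟩
  · rintro ⟨u, h, hy⟩
    exact ⟨_, h, u, rfl, hy⟩

variable (T) in
/-- The point `T.point f x` on the disc whose type is that of `ν` with respect to the labels. -/
def discPoint {ν : DiscType n k} (hx : x ∈ disc ν) (f : Frame n S) : T.Discs k :=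
  ⟨(f.1, ν.map f.2), x.permute f.2, permute_mem_disc hx f.2⟩

variable {ν : DiscType n k}

theorem discs_ext {a b : T.Discs k} (h₁ : a.1 = b.1) (h₂ : a.2.1 = b.2.1) : a = b := by
  obtain ⟨p, x, hx⟩ := a
  obtain ⟨q, y, hy⟩ := b
  obtain rfl : p = q := h₁
  obtain rfl : x = y := h₂
  rfl

theorem discPoint_one (a : T.Discs k) : T.discPoint a.2.2 (a.1.1, 1) = a :=
  discs_ext (Prod.ext rfl (DiscType.map_one a.1.2)) rfl

theorem discGlue_discPoint_iff {hx : x ∈ disc ν} {b : T.Discs k} :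
    T.DiscGlue k (T.discPoint hx f) b ↔ ∃ c ∈ zeros x, b = T.discPoint hx (T.cross c f) := by
  rw [DiscGlue, f.2.symm.exists_congr_left]
  refine exists_congr fun c => and_congr (by simp [discPoint, mem_zeros]) ?_
  simp only [Equiv.symm_symm, discPoint]
  rw [← Simplex.eq_permute_iff]
  constructor
  · rintro ⟨h₁, h₂⟩
    exact discs_ext (h₁.trans (by simp [DiscType.map_mul, cross_apply])) h₂
  · rintro rfl
    exact ⟨by simp [DiscType.map_mul, cross_apply], rfl⟩

theorem discGlue_symm (a b : T.Discs k) (hab : T.DiscGlue k a b) : T.DiscGlue k b a := by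
  rw [← discPoint_one a, discGlue_discPoint_iff] at hab
  obtain ⟨c, hc, rfl⟩ := hab
  exact discGlue_discPoint_iff.2 ⟨c, hc, by rw [cross_cross, discPoint_one]⟩

variable (T) in
/-- The quotient map from the disjoint union of the discs to the hypersurface. -/
def discProj (a : T.Discs k) : T.Hypersurface k := Quot.mk (T.DiscGlue k) a

theorem isQuotientMap_discProj : IsQuotientMap (T.discProj : T.Discs k → T.Hypersurface k) :=
  isQuotientMap_quot_mk

theorem discProj_discPoint_eq_iff {hx : x ∈ disc ν} {b : T.Discs k} :
    T.discProj (T.discPoint hx f) = T.discProj b ↔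
      ∃ g, T.Linked (zeros x) f g ∧ b = T.discPoint hx g := by
  constructor
  · intro h
    refine eq_of_quot_mk_eq (P := fun b => ∃ g, T.Linked (zeros x) f g ∧ b = T.discPoint hx g)
      discGlue_symm ?_ h ⟨f, .refl, rfl⟩
    rintro _ b hb ⟨g, hg, rfl⟩
    obtain ⟨c, hc, rfl⟩ := discGlue_discPoint_iff.1 hb
    exact ⟨_, hg.tail ⟨c, hc, rfl⟩, rfl⟩
  · rintro ⟨g, hg, rfl⟩
    induction hg with
    | refl => rfl
    | tail _ h ih =>
      obtain ⟨c, hc, rfl⟩ := h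
      exact ih.trans (Quot.sound (discGlue_discPoint_iff.2 ⟨c, hc, rfl⟩))

end Triangulation

theorem Simplex.preimage_zeros_of_permute_eq {u : Equiv.Perm (Fin (n + 1))} {x : Simplex n}
    (hu : x.permute u = x) : u ⁻¹' zeros x = zeros x := by
  simpa only [hu] using preimage_zeros_permute u x

theorem Simplex.eventually_zeros_subset (x : Simplex n) : ∀ᶠ y in 𝓝 x, zeros y ⊆ zeros x := by
  have h : ∀ l, ∀ᶠ y : Simplex n in 𝓝 x, y l = 0 → x l = 0 := fun l => by
    by_cases hl : x l = 0
    · exact .of_forall fun _ _ => hl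
    · filter_upwards [(continuous_coord l).continuousAt.eventually_ne hl] with y hy h0
      exact absurd h0 hy
  exact (Filter.eventually_all.2 h).mono fun y hy l => hy l

theorem Simplex.exists_isOpen_permute (x : Simplex n) :
    ∃ W : Set (Simplex n), IsOpen W ∧ x ∈ W ∧ (∀ y ∈ W, zeros y ⊆ zeros x) ∧
      ∀ (u : Equiv.Perm (Fin (n + 1))), ∀ y ∈ W, y.permute u ∈ W → x.permute u = x := by
  have hsep : ∀ u : Equiv.Perm (Fin (n + 1)),
      ∃ V ∈ 𝓝 x, ∀ y ∈ V, y.permute u ∈ V → x.permute u = x := fun u => by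
    by_cases hu : x.permute u = x
    · exact ⟨Set.univ, Filter.univ_mem, fun _ _ _ => hu⟩
    · obtain ⟨A, B, hA, hB, hxA, hxB, hAB⟩ := t2_separation hu
      refine ⟨Simplex.permute u ⁻¹' A ∩ B, Filter.inter_mem ?_ (hB.mem_nhds hxB),
        fun y hy hyu => absurd hyu.2 (hAB.notMem_of_mem_left hy.1)⟩
      exact (hA.preimage (Simplex.continuous_permute u)).mem_nhds hxA
  choose V hV hVu using hsep
  obtain ⟨W, hW, hWo, hxW⟩ := mem_nhds_iff.1
    (Filter.inter_mem (Filter.iInter_mem.2 hV) x.eventually_zeros_subset)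
  exact ⟨W, hWo, hxW, fun y hy => (hW hy).2, fun u y hy hyu =>
    hVu u y (Set.mem_iInter.1 (hW hy).1 u) (Set.mem_iInter.1 (hW hyu).1 u)⟩

theorem Simplex.exists_mem_nhds_add_mul {x : Simplex n} {N : Set (Simplex n)} (hN : N ∈ 𝓝 x)
    {v : Fin (n + 1) → ℝ} (hv : ∑ l, v l = 0) (hv0 : ∀ l ∈ zeros x, 0 ≤ v l) :
    ∃ y ∈ N, (∃ t > 0, ∀ l, y l = x l + t * v l) ∧ zeros y = {l ∈ zeros x | v l = 0} := by
  obtain ⟨N', hN', hNN'⟩ := mem_nhds_induced _ _ _ |>.1 hN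
  have hcont : Continuous fun (t : ℝ) (l : Fin (n + 1)) => x l + t * v l := by fun_prop
  have hmem : ∀ᶠ t : ℝ in 𝓝[>] 0, (fun l => x l + t * v l) ∈ N' :=
    nhdsWithin_le_nhds (hcont.continuousAt.eventually_mem (by simpa only [zero_mul, add_zero]))
  have hpos : ∀ᶠ t : ℝ in 𝓝[>] 0, ∀ l, l ∉ zeros x → 0 < x l + t * v l := by
    refine nhdsWithin_le_nhds (Filter.eventually_all.2 fun l => ?_)
    by_cases hl : l ∈ zeros x
    · exact .of_forall fun t h => absurd hl h
    · have hl0 : 0 < x l := (stdSimplex.zero_le x l).lt_of_ne' hl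
      have := (continuous_apply l).comp hcont
      filter_upwards [this.continuousAt.eventually_const_lt (u := 0) (by simpa using hl0)] with
        t ht _ using ht
  obtain ⟨t, ht, htN, htpos⟩ := (eventually_mem_nhdsWithin.and (hmem.and hpos)).exists
  have ht0 : 0 < t := ht
  have hnonneg : ∀ l, 0 ≤ x l + t * v l := fun l => by
    by_cases hl : l ∈ zeros x
    · rw [mem_zeros.1 hl, zero_add]
      exact mul_nonneg ht0.le (hv0 l hl)
    · exact (htpos l hl).le
  refine ⟨⟨fun l => x l + t * v l, hnonneg, ?_⟩, hNN' htN, ⟨t, ht0, fun l => rfl⟩, ?_⟩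
  · rw [Finset.sum_add_distrib, ← Finset.mul_sum, hv, mul_zero, add_zero, stdSimplex.sum_eq_one]
  · ext l
    change x l + t * v l = 0 ↔ x l = 0 ∧ v l = 0
    by_cases hl : l ∈ zeros x
    · simp [mem_zeros.1 hl, ht0.ne']
    · simp [(htpos l hl).ne', mt mem_zeros.2 hl]

namespace Triangulation

variable {S : Type*} {T : Triangulation n S} {f : Frame n S} {x : Simplex n}

theorem IsFree.apply_eq_self (hfree : T.IsFree (T.point f x)) {u : Equiv.Perm (Fin (n + 1))}
    (hu : T.Linked (zeros x) f (relabel u f)) (hux : x.permute u = x) {l : Fin (n + 1)}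
    (hl : x l ≠ 0) : u l = l := by
  by_contra hne
  obtain ⟨V, hV, hinj⟩ := hfree
  have hul : x (u l) = x l := Simplex.eq_permute_iff.1 hux.symm l
  have hVf : Simplex.permute f.2 ⁻¹' V ∈ 𝓝 x := (Simplex.continuous_permute f.2).continuousAt hV
  have hVu : Simplex.permute u ⁻¹' (Simplex.permute f.2 ⁻¹' V) ∈ 𝓝 x :=
    (Simplex.continuous_permute u).continuousAt (hux.symm ▸ hVf)
  let v : Fin (n + 1) → ℝ := Pi.single l 1 - Pi.single (u l) 1
  have hv : ∀ r ∈ zeros x, v r = 0 := fun r hr => by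
    have hrl : r ≠ l := fun h => hl (h ▸ hr)
    have hrul : r ≠ u l := fun h => hl (hul ▸ h ▸ hr)
    simp [v, hrl, hrul]
  obtain ⟨y, ⟨hyf, hyu⟩, ⟨t, ht, hy⟩, hzy⟩ := Simplex.exists_mem_nhds_add_mul
    (Filter.inter_mem hVf hVu) (v := v) (by simp [v]) fun r hr => (hv r hr).ge
  replace hzy : zeros y = zeros x := hzy.trans (Set.sep_eq_self_iff_mem_true.2 hv)
  have hzyu : zeros (y.permute u) = zeros x := by
    simpa only [hux] using zeros_permute_eq_iff (w := u).2 hzy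
  have hproj : T.proj (T.point f y) = T.proj (T.point f (y.permute u)) :=
    (hzy ▸ hu : T.Linked (zeros y) f (relabel u f)).proj_point_eq
  have hyyu : y.permute f.2 = (y.permute u).permute f.2 := hinj _ hyf _ hyu
    (support_eq_support_iff.2 (zeros_permute_eq_iff.2 hzy))
    (support_eq_support_iff.2 (zeros_permute_eq_iff.2 hzyu)) hproj
  have hyl := Simplex.eq_permute_iff.1 ((Simplex.permute_bijective f.2).1 hyyu) l
  simp [hy, v, hul, hne, Ne.symm hne] at hyl
  linarith

theorem isFree_point_of_forall_apply_eq_self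
    (h : ∀ u, T.Linked (zeros x) f (relabel u f) → x.permute u = x → ∀ l, x l ≠ 0 → u l = l) :
    T.IsFree (T.point f x) := by
  obtain ⟨W, hWo, hxW, -, hWu⟩ := x.exists_isOpen_permute
  refine ⟨Simplex.permute f.2⁻¹ ⁻¹' W,
    (hWo.preimage (Simplex.continuous_permute _)).mem_nhds (by simpa [point] using hxW), ?_⟩
  intro y hy z hz hsy _ hyz
  obtain ⟨y, rfl⟩ := (Simplex.permute_bijective f.2).2 y
  obtain ⟨z, rfl⟩ := (Simplex.permute_bijective f.2).2 z
  obtain ⟨u, hu, rfl⟩ := proj_point_eq_proj_point_iff.1 hyz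
  have hzy : zeros y = zeros x := zeros_permute_eq_iff.1 (support_eq_support_iff.1 hsy)
  have hux := hWu u y (by simpa using hy) (by simpa using hz)
  have hfix := h u (hzy ▸ hu) hux
  congr 1
  refine Simplex.eq_permute_iff.2 fun l => ?_
  by_cases hl : x l = 0
  · have hul : u l ∈ zeros x := (Simplex.eq_permute_iff.1 hux.symm l).trans hl
    rw [← hzy] at hul
    have hl' : l ∈ zeros y := hzy ▸ hl
    rw [mem_zeros.1 hul, mem_zeros.1 hl']
  · rw [hfix l hl]

theorem IsFree.of_proj_eq {a b : T.Delta} (ha : T.IsFree a) (hab : T.proj a = T.proj b) :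
    T.IsFree b := by
  rw [← point_one a, proj_point_eq_iff] at hab
  obtain ⟨g, hg, rfl⟩ := hab
  refine isFree_point_of_forall_apply_eq_self fun u hu hux l hl => ?_
  rw [← point_one a] at ha
  have hgu := hg.map_relabel u
  rw [Simplex.preimage_zeros_of_permute_eq hux] at hgu
  exact ha.apply_eq_self ((hg.trans hu).trans hgu.symm) hux hl

end Triangulation

/-! ### Holonomy and degrees -/

theorem exists_eq_swap_of_ncard_le_two {α : Type*} [Finite α] [DecidableEq α] {u : Equiv.Perm α}
    {Z : Set α} (hZ : Z.ncard ≤ 2) (hu : ∀ l ∉ Z, u l = l) (hu1 : u ≠ 1) :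
    ∃ i j, i ≠ j ∧ Z = {i, j} ∧ u = Equiv.swap i j := by
  cases nonempty_fintype α
  have hsub : (u.support : Set α) ⊆ Z := fun l hl => by
    by_contra hlZ
    exact Equiv.Perm.mem_support.1 hl (hu l hlZ)
  have hle := (Set.ncard_coe_finset u.support).symm.trans_le (Set.ncard_le_ncard hsub)
  have hcard : u.support.card = 2 :=
    le_antisymm (hle.trans hZ) (Equiv.Perm.two_le_card_support_of_ne_one hu1)
  obtain ⟨i, j, hij, rfl⟩ := Equiv.Perm.card_support_eq_two.1 hcard
  refine ⟨i, j, hij, ?_, rfl⟩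
  rw [← Set.eq_of_subset_of_ncard_le hsub (by rwa [Set.ncard_coe_finset, hcard]),
    Equiv.Perm.support_swap hij, Finset.coe_pair]

theorem swap_zpow {α : Type*} [DecidableEq α] (i j : α) (e : ℤ) :
    Equiv.swap i j ^ e = if Even e then 1 else Equiv.swap i j := by
  rcases Int.even_or_odd' e with ⟨m, rfl | rfl⟩
  · simp [zpow_mul, zpow_ofNat, sq]
  · simp [zpow_add, zpow_mul, zpow_ofNat, sq]

theorem Simplex.permute_swap_of_eq {x : Simplex n} (hij : x i = x j) :
    x.permute (Equiv.swap i j) = x := by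
  refine (Simplex.eq_permute_iff.2 fun l => ?_).symm
  rw [Equiv.swap_apply_def]
  split_ifs with h h <;> simp [*]

theorem Simplex.permute_swap_of_zeros_eq {x : Simplex n}
    (hz : zeros x = {i, j}) : x.permute (Equiv.swap i j) = x :=
  have hij : x i = 0 ∧ x j = 0 := ⟨mem_zeros.1 (by simp [hz]), mem_zeros.1 (by simp [hz])⟩
  permute_swap_of_eq (hij.1.trans hij.2.symm)

namespace Triangulation

variable {S : Type*} {T : Triangulation n S} {f g : Frame n S} {x : Simplex n}
  {u : Equiv.Perm (Fin (n + 1))}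

theorem proj_mem_skeleton_iff {d : ℕ} {a : T.Delta} :
    T.proj a ∈ T.skeleton d ↔ (support a.2).card ≤ d + 1 := by
  refine ⟨fun ⟨b, hb, hba⟩ => ?_, fun h => ⟨a, h, rfl⟩⟩
  rw [← point_one b, proj_point_eq_iff] at hba
  obtain ⟨g, -, rfl⟩ := hba
  have h₁ := ncard_zeros_add_card_support b.2
  have h₂ := ncard_zeros_add_card_support (T.point g b.2).2
  rw [point, ncard_zeros_permute] at h₂
  have hb' : (support b.2).card ≤ d + 1 := hb
  change (support (b.2.permute g.2)).card ≤ d + 1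
  change _ + (support (b.2.permute g.2)).card = n + 1 at h₂
  omega

theorem isRegular_proj_iff (hn : 3 ≤ n) {a : T.Delta} :
    T.IsRegular (T.proj a) ↔ (zeros a.2).ncard ≤ 2 ∧ T.IsFree a := by
  have h := ncard_zeros_add_card_support a.2
  refine and_congr ?_ ⟨fun ha => ha a rfl, fun ha b hb => ha.of_proj_eq hb.symm⟩
  rw [proj_mem_skeleton_iff]
  omega

variable (T) in
/-- The orientation of the simplex of a frame, relative to the order of the labels. -/
def frameSign (f : Frame n S) : ℤˣ := Equiv.Perm.sign f.2 * T.orient f.1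

theorem frameSign_cross (c : Fin (n + 1)) (f : Frame n S) :
    T.frameSign (T.cross c f) = -T.frameSign f := by
  have h := T.orient_reversing f.1 (f.2 c)
  rw [frameSign, frameSign, cross_apply, map_mul]
  rcases Int.units_eq_one_or (T.orient f.1) with h₁ | h₁ <;>
    rcases Int.units_eq_one_or (T.orient (T.nbr f.1 (f.2 c))) with h₂ | h₂ <;>
      simp_all

theorem frameSign_relabel (u : Equiv.Perm (Fin (n + 1))) (f : Frame n S) :
    T.frameSign (relabel u f) = Equiv.Perm.sign u * T.frameSign f := by
  change Equiv.Perm.sign (f.2 * u) * T.orient f.1 = _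
  rw [map_mul, mul_comm (Equiv.Perm.sign f.2), mul_assoc, frameSign]

variable (T) in
/-- One step of the walk around the codimension-two face opposite to the corners labelled `i` and
`j`. The relabelling after the face pairing makes all steps alike, so that the walk is the iteration
of one permutation of the frames. -/
def walk (i j : Fin (n + 1)) : Equiv.Perm (Frame n S) := relabel (Equiv.swap i j) * T.cross i

theorem walk_apply (f : Frame n S) :
    T.walk i j f = relabel (Equiv.swap i j) (T.cross i f) := rfl

theorem frameSign_walk_zpow (hij : i ≠ j) (e : ℤ) (f : Frame n S) :
    T.frameSign ((T.walk i j ^ e) f) = T.frameSign f := by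
  have hwalk : ∀ f, T.frameSign (T.walk i j f) = T.frameSign f := fun f => by
    rw [walk_apply, frameSign_relabel, frameSign_cross, Equiv.Perm.sign_swap hij, neg_one_mul,
      neg_neg]
  refine zpow_induction_left (g := T.walk i j)
    (P := fun w => ∀ f, T.frameSign (w f) = T.frameSign f)
    (fun _ => rfl) (fun w hw f => ?_) (fun w hw f => ?_) e f
  · rw [Equiv.Perm.mul_apply, hwalk, hw]
  · rw [← hwalk, ← Equiv.Perm.mul_apply, mul_inv_cancel_left, hw]

variable (T) in
/-- The frames met on the walk around a codimension-two face, with the labels carried along by the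
face pairings: the relabellings made by `walk` are undone. -/
def gallery (i j : Fin (n + 1)) (f : Frame n S) (e : ℤ) : Frame n S :=
  relabel (Equiv.swap i j ^ e) ((T.walk i j ^ e) f)

theorem gallery_add_one (i j : Fin (n + 1)) (f : Frame n S) (e : ℤ) :
    T.gallery i j f (e + 1) = T.cross ((Equiv.swap i j ^ e) i) (T.gallery i j f e) := by
  have hs : (Equiv.swap i j ^ e) ((Equiv.swap i j ^ e) i) = i := by
    rw [← Equiv.Perm.mul_apply, ← (Commute.refl _).mul_zpow, Equiv.swap_mul_self, one_zpow,
      Equiv.Perm.one_apply]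
  rw [gallery, gallery, cross_relabel, hs, add_comm e, zpow_add, zpow_add, zpow_one, zpow_one,
    Equiv.Perm.mul_apply, walk_apply, relabel_relabel, ← mul_assoc, Equiv.swap_mul_self, one_mul]

theorem linked_gallery (i j : Fin (n + 1)) (f : Frame n S) (e : ℤ) :
    T.Linked {i, j} f (T.gallery i j f e) := by
  have hmem : ∀ e : ℤ, (Equiv.swap i j ^ e) i ∈ ({i, j} : Set (Fin (n + 1))) := fun e => by
    rcases Int.even_or_odd e with he | he <;> simp [swap_zpow, he, Int.not_even_iff_odd.2]
  induction e with
  | zero => exact .refl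
  | succ e ih => exact ih.tail ⟨_, hmem e, gallery_add_one i j f e⟩
  | pred e ih =>
    refine ih.tail ⟨_, hmem (-e - 1), ?_⟩
    have := gallery_add_one (T := T) i j f (-e - 1)
    rw [sub_add_cancel] at this
    rw [this, cross_cross]

theorem linked_pair_iff : T.Linked {i, j} f g ↔ ∃ e : ℤ, g = T.gallery i j f e := by
  refine ⟨fun h => ?_, fun ⟨e, he⟩ => he ▸ linked_gallery i j f e⟩
  induction h with
  | refl => exact ⟨0, rfl⟩
  | tail _ h ih =>
    obtain ⟨c, hc, rfl⟩ := h
    obtain ⟨e, rfl⟩ := ih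
    have hc' : c = (Equiv.swap i j ^ e) i ∨ c = (Equiv.swap i j ^ (e - 1)) i := by
      rcases Int.even_or_odd e with he | he <;> rcases hc with rfl | rfl <;>
        simp [swap_zpow, he, Int.not_even_iff_odd.2]
    rcases hc' with rfl | rfl
    · exact ⟨e + 1, (gallery_add_one i j f e).symm⟩
    · refine ⟨e - 1, ?_⟩
      nth_rw 2 [← sub_add_cancel e 1]
      rw [gallery_add_one, cross_cross]

/-- Relabellings that preserve the orientation cannot exchange the two corners opposite to a face of
codimension two. -/
theorem eq_one_of_walk_zpow_eq_relabel (hij : i ≠ j) (hz : zeros x = {i, j})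
    (hfree : T.IsFree (T.point f x)) {e : ℤ} (he : (T.walk i j ^ e) f = relabel u f)
    (hux : x.permute u = x) : u = 1 := by
  have hgal : T.gallery i j f e = relabel (u * Equiv.swap i j ^ e) f := by
    rw [gallery, he, relabel_relabel]
  have hx : x.permute (u * Equiv.swap i j ^ e) = x := by
    rw [Simplex.permute_mul, swap_zpow]
    split_ifs
    · exact hux
    · rw [Simplex.permute_swap_of_zeros_eq hz, hux]
  have hfix : ∀ l ∉ zeros x, u l = l := fun l hl => by
    have := hfree.apply_eq_self (hgal ▸ hz ▸ linked_gallery i j f e) hx hl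
    rw [hz] at hl
    simp only [Set.mem_insert_iff, Set.mem_singleton_iff, not_or] at hl
    rw [swap_zpow] at this
    split_ifs at this with hev
    · simpa using this
    · simpa [Equiv.swap_apply_of_ne_of_ne hl.1 hl.2] using this
  have hsign : Equiv.Perm.sign u = 1 := by
    have := frameSign_walk_zpow (T := T) hij e f
    rwa [he, frameSign_relabel, mul_eq_right] at this
  by_contra hu1
  obtain ⟨i, j, hij, -, rfl⟩ := exists_eq_swap_of_ncard_le_two
    (by rw [hz, Set.ncard_pair hij]) hfix hu1
  simp [Equiv.Perm.sign_swap hij] at hsign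

theorem point_gallery (hz : zeros x = {i, j}) (e : ℤ) :
    T.point (T.gallery i j f e) x = T.point ((T.walk i j ^ e) f) x := by
  rw [gallery, point_relabel, swap_zpow]
  split_ifs
  · rfl
  · rw [Simplex.permute_swap_of_zeros_eq hz]

theorem preimage_proj_point_eq_image_orbit (hz : zeros x = {i, j}) :
    T.proj ⁻¹' {T.proj (T.point f x)} =
      (T.point · x) '' MulAction.orbit (Subgroup.zpowers (T.walk i j)) f := by
  ext a
  simp only [Set.mem_preimage, Set.mem_singleton_iff, Set.mem_image]
  rw [eq_comm, proj_point_eq_iff, hz]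
  constructor
  · rintro ⟨g, hg, rfl⟩
    obtain ⟨e, rfl⟩ := linked_pair_iff.1 hg
    exact ⟨_, ⟨⟨T.walk i j ^ e, e, rfl⟩, rfl⟩, (point_gallery hz e).symm⟩
  · rintro ⟨_, ⟨⟨_, e, rfl⟩, rfl⟩, rfl⟩
    exact ⟨_, linked_gallery i j f e, (point_gallery hz e).symm⟩

theorem fibreCard_eq_minimalPeriod (hij : i ≠ j) (hz : zeros x = {i, j})
    (hfree : T.IsFree (T.point f x)) :
    T.fibreCard (T.proj (T.point f x)) = Function.minimalPeriod (T.walk i j • ·) f := by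
  have hinj : Set.InjOn (T.point · x)
      (MulAction.orbit (Subgroup.zpowers (T.walk i j)) f) := by
    rintro _ ⟨⟨_, d, rfl⟩, rfl⟩ _ ⟨⟨_, e, rfl⟩, rfl⟩ h
    change T.point ((T.walk i j ^ d) f) x = T.point ((T.walk i j ^ e) f) x at h
    change (T.walk i j ^ d) f = (T.walk i j ^ e) f
    obtain ⟨u, hu, hux⟩ := point_eq_point_iff.1 h
    have hproj : T.proj (T.point f x) = T.proj (T.point ((T.walk i j ^ d) f) x) := by
      rw [← point_gallery hz]
      exact (hz ▸ linked_gallery i j f d : T.Linked (zeros x) f _).proj_point_eq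
    have hwalk : (T.walk i j ^ (e - d)) ((T.walk i j ^ d) f) = relabel u ((T.walk i j ^ d) f) := by
      rw [← hu, ← Equiv.Perm.mul_apply, ← zpow_add, sub_add_cancel]
    rw [hu, eq_one_of_walk_zpow_eq_relabel hij hz (hfree.of_proj_eq hproj) hwalk hux.symm,
      relabel_one]
  rw [fibreCard, preimage_proj_point_eq_image_orbit hz, hinj.ncard_image, ← Nat.card_coe_set_eq,
    Nat.card_congr (MulAction.orbitZPowersEquiv (T.walk i j) f), Nat.card_zmod]

theorem odd_fibreCard_iff (hij : i ≠ j) (hz : zeros x = {i, j})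
    (hfree : T.IsFree (T.point f x)) :
    Odd (T.fibreCard (T.proj (T.point f x))) ↔
      T.Linked {i, j} f (relabel (Equiv.swap i j) f) := by
  have hperiod : ∀ e : ℤ, (T.walk i j ^ e) f = f ↔
      (Function.minimalPeriod (T.walk i j • ·) f : ℤ) ∣ e := fun e =>
    MulAction.zpow_smul_eq_iff_minimalPeriod_dvd (a := T.walk i j) (b := f)
  rw [fibreCard_eq_minimalPeriod hij hz hfree, linked_pair_iff]
  constructor
  · intro hodd
    refine ⟨Function.minimalPeriod (T.walk i j • ·) f, ?_⟩
    rw [gallery, (hperiod _).2 dvd_rfl, swap_zpow, if_neg (by simpa using hodd)]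
  · rintro ⟨e, he⟩
    have hsign := frameSign_walk_zpow (T := T) hij e f
    rw [gallery, swap_zpow] at he
    split_ifs at he with heven
    · rw [relabel_one] at he
      rw [← he, frameSign_relabel, Equiv.Perm.sign_swap hij, mul_eq_right] at hsign
      exact absurd hsign (by decide)
    · have hdvd := (hperiod e).1 ((relabel _).injective he.symm)
      rw [even_iff_two_dvd] at heven
      exact (Int.odd_coe_nat _).1 (Int.not_even_iff_odd.1 fun hp => heven (hp.two_dvd.trans hdvd))

variable (T) in
/-- No frame is linked to a nontrivial relabelling of itself that fixes a regular point. -/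
def HasTrivialHolonomy : Prop :=
  ∀ (f : Frame n S) (x : Simplex n), T.IsRegular (T.proj (T.point f x)) →
    ∀ u, T.Linked (zeros x) f (relabel u f) → x.permute u = x → u = 1

variable (T) in
/-- Every `(n - 2)`-singlex of finite degree has even degree. This agrees with `IsEven` if there are
finitely many simplices, but does not use that `Set.ncard` assigns the degree `0` to infinite
fibres. -/
def FiniteDegreesEven : Prop :=
  ∀ a : T.Delta, (support a.2).card = n - 1 → T.IsRegular (T.proj a) →
    (T.proj ⁻¹' {T.proj a}).Finite → Even (T.fibreCard (T.proj a))

theorem finite_preimage_proj [Finite S] (a : T.Delta) : (T.proj ⁻¹' {T.proj a}).Finite := by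
  refine (Set.finite_range fun f : Frame n S => T.point f a.2).subset fun b hb => ?_
  obtain ⟨g, -, rfl⟩ := proj_point_eq_iff.1 ((congrArg T.proj (point_one a)).trans hb.symm)
  exact ⟨g, rfl⟩

variable (T) in
theorem finiteDegreesEven_iff_isEven [Finite S] : T.FiniteDegreesEven ↔ T.IsEven :=
  forall₃_congr fun a _ _ => forall_prop_of_true (finite_preimage_proj a)

theorem hasTrivialHolonomy_iff_finiteDegreesEven (hn : 3 ≤ n) :
    T.HasTrivialHolonomy ↔ T.FiniteDegreesEven := by
  constructor
  · intro hT a hcard hreg _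
    by_contra hodd
    rw [Nat.not_even_iff_odd, ← point_one a] at hodd
    obtain ⟨i, j, hij, hz⟩ := Set.ncard_eq_two.1
      (show (zeros a.2).ncard = 2 by have := ncard_zeros_add_card_support a.2; omega)
    have hlinked := (odd_fibreCard_iff hij hz ((isRegular_proj_iff hn).1 hreg).2).1 hodd
    rw [← hz] at hlinked
    have hswap := hT (a.1, 1) a.2 hreg _ hlinked (Simplex.permute_swap_of_zeros_eq hz)
    exact hij (Equiv.swap_eq_one_iff.1 hswap)
  · intro hT f x hreg u hu hux
    by_contra hu1
    obtain ⟨hcard, hfree⟩ := (isRegular_proj_iff hn).1 hreg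
    obtain ⟨i, j, hij, hz, rfl⟩ := exists_eq_swap_of_ncard_le_two
      (show (zeros x).ncard ≤ 2 by simpa [point, ncard_zeros_permute] using hcard)
      (fun l hl => hfree.apply_eq_self hu hux hl) hu1
    have hodd := (odd_fibreCard_iff hij hz hfree).2 (hz ▸ hu)
    refine Nat.not_even_iff_odd.2 hodd (hT _ ?_ hreg (Set.finite_of_ncard_ne_zero hodd.pos.ne'))
    have := ncard_zeros_add_card_support (x.permute f.2)
    rw [ncard_zeros_permute, hz, Set.ncard_pair hij] at this
    simp only [point]
    omega

end Triangulation

/-! ### Regular points on faces of codimension two -/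

theorem injOn_of_forall_lt {α β : Type*} [Preorder β] {x : α → β} {s : Set α} {p q : α}
    (hs : Set.InjOn x (s \ {p, q})) (hlt : ∀ l ∈ s \ {p, q}, x l < x p ∧ x l < x q)
    (hpq : x p ≠ x q) : Set.InjOn x s := by
  intro l hl l' hl' h
  by_cases hlpq : l ∈ ({p, q} : Set α) <;> by_cases hlpq' : l' ∈ ({p, q} : Set α)
  · rcases hlpq with rfl | rfl <;> rcases hlpq' with rfl | rfl <;>
      first | rfl | exact absurd h hpq | exact absurd h.symm hpq
  · obtain ⟨hp, hq⟩ := hlt l' ⟨hl', hlpq'⟩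
    rcases hlpq with rfl | rfl
    exacts [absurd h hp.ne', absurd h hq.ne']
  · obtain ⟨hp, hq⟩ := hlt l ⟨hl, hlpq⟩
    rcases hlpq' with rfl | rfl
    exacts [absurd h hp.ne, absurd h hq.ne]
  · exact hs ⟨hl, hlpq⟩ ⟨hl', hlpq'⟩ h

theorem sum_two_pow_injective (m : ℕ) :
    Function.Injective fun B : Finset (Fin m) => ∑ l ∈ B, (2 : ℝ) ^ (l : ℕ) := fun B C h => by
  have hmap : ∀ B : Finset (Fin m),
      ∑ l ∈ B, (2 : ℝ) ^ (l : ℕ) = ((∑ l ∈ B.map Fin.valEmbedding, 2 ^ l : ℕ) : ℝ) := fun B => by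
    simp
  simp only [hmap, Nat.cast_inj] at h
  exact Finset.map_injective _ (Finset.geomSum_injective le_rfl h)

theorem Simplex.exists_eq_half_eq_half (hpq : p ≠ q) :
    ∃ x : Simplex n, x p = 1 / 2 ∧ x q = 1 / 2 ∧ zeros x = {p, q}ᶜ := by
  let x : Simplex n := ⟨midpoint ℝ (corner p) (corner q),
    (convex_stdSimplex ℝ _).midpoint_mem (single_mem_stdSimplex ℝ p) (single_mem_stdSimplex ℝ q)⟩
  have hx : ∀ l, x l = (1 / 2) * (corner p l + corner q l) := fun l => by
    change midpoint ℝ (corner p) (corner q) l = _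
    simp [midpoint_eq_smul_add, mul_add]
  have hxp : x p = 1 / 2 := by simp [hx, hpq]
  have hxq : x q = 1 / 2 := by simp [hx, hpq.symm]
  refine ⟨x, hxp, hxq, ?_⟩
  ext l
  rw [Set.mem_compl_iff, Set.mem_insert_iff, Set.mem_singleton_iff, not_or]
  constructor
  · intro hl
    constructor <;> rintro rfl <;> simp_all [mem_zeros]
  · rintro ⟨hlp, hlq⟩
    simp [mem_zeros, hx, hlp, hlq]

theorem Simplex.exists_eq_mul_of_sum_eq_half {A : Finset (Fin (n + 1))} (hp : p ∈ A) (hq : q ∉ A)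
    {w : Fin (n + 1) → ℝ} (hw : ∀ l, 0 ≤ w l) (hwp : w p = 0) (hwq : w q = 0) :
    ∃ x : Simplex n, ∃ t > 0, zeros x = {l | w l = 0} \ {p, q} ∧ ∑ l ∈ A, x l = 1 / 2 ∧
      x p = 1 / 2 - t * ∑ l ∈ A, w l ∧ x q = 1 / 2 - t * ∑ l ∈ Aᶜ, w l ∧
        ∀ l ∉ ({p, q} : Set _), x l = t * w l ∧ x l < x p ∧ x l < x q := by
  have hpq : p ≠ q := fun h => hq (h ▸ hp)
  let v : Fin (n + 1) → ℝ :=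
    w - (Pi.single p (∑ l ∈ A, w l) + Pi.single q (∑ l ∈ Aᶜ, w l) : Fin (n + 1) → ℝ)
  have hvl : ∀ l ∉ ({p, q} : Set _), v l = w l := fun l hl => by
    rw [Set.mem_insert_iff, Set.mem_singleton_iff, not_or] at hl
    simp [v, hl.1, hl.2]
  have hvA : ∑ l ∈ A, v l = 0 := by
    simp [v, Finset.sum_add_distrib, hp, hq]
  have hv : ∑ l, v l = 0 := by
    rw [← Finset.sum_add_sum_compl A, hvA]
    simp [v, Finset.sum_add_distrib, hp, hq]
  obtain ⟨x₀, hx₀p, hx₀q, hz₀⟩ := exists_eq_half_eq_half hpq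
  have hx₀l : ∀ l ∉ ({p, q} : Set _), x₀ l = 0 := fun l hl => hz₀.ge hl
  have hnear : ∀ᶠ x in 𝓝 x₀, ∀ l ∉ ({p, q} : Set _), x l < x p ∧ x l < x q := by
    have hcont := fun l => (Simplex.continuous_coord l).continuousAt (x := x₀)
    refine Filter.eventually_all.2 fun l => Filter.eventually_imp_distrib_left.2 fun hl => ?_
    refine ((hcont l).eventually_lt (hcont p) ?_).and ((hcont l).eventually_lt (hcont q) ?_)
    · rw [hx₀l l hl, hx₀p]; norm_num
    · rw [hx₀l l hl, hx₀q]; norm_num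
  obtain ⟨x, hx, ⟨t, ht, hxt⟩, hz⟩ := Simplex.exists_mem_nhds_add_mul hnear hv fun l hl => by
    rw [hvl l (hz₀.le hl)]
    exact hw l
  refine ⟨x, t, ht, ?_, ?_, ?_, ?_, fun l hl => ⟨?_, hx l hl⟩⟩
  · ext l
    rw [hz, hz₀]
    constructor
    · rintro ⟨hl, hvl0⟩
      exact ⟨(hvl l hl).symm.trans hvl0, hl⟩
    · rintro ⟨hwl, hl⟩
      exact ⟨hl, (hvl l hl).trans hwl⟩
  · simp only [hxt, Finset.sum_add_distrib, ← Finset.mul_sum, hvA, mul_zero, add_zero]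
    rw [Finset.sum_eq_single_of_mem p hp, hx₀p]
    exact fun l hl hlp => hx₀l l (by rintro (h | rfl) <;> contradiction)
  · rw [hxt, hx₀p]; simp [v, hpq, hwp, sub_eq_add_neg]
  · rw [hxt, hx₀q]; simp [v, hpq.symm, hwq, sub_eq_add_neg]
  · rw [hxt, hx₀l l hl, hvl l hl, zero_add]

/-- Almost half the weight goes to each of `p` and `q`, and small multiples of different powers of
two to the corners other than `i`, `j`, `p`, `q`. The coordinates at `p` and `q` then differ because
binary expansions are unique, unless there are no other corners. -/
theorem exists_zeros_eq_pair_injOn {A : Finset (Fin (n + 1))} (hi : i ∈ A) (hj : j ∉ A)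
    (hp : p ∈ A) (hpi : p ≠ i) (hq : q ∉ A) (hqj : q ≠ j) :
    ∃ x : Simplex n, zeros x = {i, j} ∧ ∑ l ∈ A, x l = 1 / 2 ∧
      (n ≤ 3 ∨ Set.InjOn x (zeros x)ᶜ) := by
  let E : Finset (Fin (n + 1)) := {i, j, p, q}
  let w : Fin (n + 1) → ℝ := fun l => if l ∉ E then 2 ^ (l : ℕ) else 0
  have hwE : ∀ l, l ∉ E → w l = 2 ^ (l : ℕ) := fun l hl => if_pos hl
  have hw0 : ∀ l, w l = 0 ↔ l ∈ E := fun l => by simp [w]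
  obtain ⟨x, t, ht, hz, hxA, hxp, hxq, hxl⟩ := Simplex.exists_eq_mul_of_sum_eq_half
    (w := w) hp hq (fun l => by simp only [w]; split_ifs <;> positivity) (by simp [hw0, E])
    (by simp [hw0, E])
  have hzij : zeros x = {i, j} := by
    have hip : i ≠ q := fun h => hq (h ▸ hi)
    have hjp : j ≠ p := fun h => hj (h ▸ hp)
    ext l
    simp only [hz, hw0, E]
    simp only [Finset.mem_insert, Finset.mem_singleton, Set.mem_sdiff, Set.mem_ofPred_eq,
      Set.mem_insert_iff, Set.mem_singleton_iff]
    grind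
  refine ⟨x, hzij, hxA, or_iff_not_imp_right.2 fun hinj => ?_⟩
  have hxpq : x p = x q := by
    by_contra hne
    refine hinj (injOn_of_forall_lt ?_ (fun l hl => (hxl l hl.2).2) hne)
    rintro l ⟨hlz, hl⟩ l' ⟨hlz', hl'⟩ h
    rw [hzij] at hlz hlz'
    rw [(hxl l hl).1, (hxl l' hl').1, mul_right_inj' ht.ne', hwE l (by simp_all [E]),
      hwE l' (by simp_all [E])] at h
    exact Fin.ext (pow_right_injective₀ (by norm_num) (by norm_num) h)
  have hfilter : ∀ B : Finset (Fin (n + 1)),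
      ∑ l ∈ B, w l = ∑ l ∈ B.filter (· ∉ E), 2 ^ (l : ℕ) := fun B => (Finset.sum_filter _ _).symm
  rw [hxp, hxq, sub_right_inj, mul_right_inj' ht.ne', hfilter, hfilter] at hxpq
  have huniv : Finset.univ ⊆ E := fun l _ => by
    have := Finset.ext_iff.1 (sum_two_pow_injective _ hxpq) l
    simp only [Finset.mem_filter, Finset.mem_compl] at this
    tauto
  have := (Finset.card_le_card huniv).trans Finset.card_le_four
  rw [Finset.card_fin] at this
  omega

namespace Triangulation

variable {S : Type*} {T : Triangulation n S} {f : Frame n S} {x : Simplex n}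
  {v : Equiv.Perm (Fin (n + 1))}

theorem isFree_point_of_injOn (hx : Set.InjOn x (zeros x)ᶜ) : T.IsFree (T.point f x) :=
  isFree_point_of_forall_apply_eq_self fun u _ hux l hl => by
    have hul : x (u l) = x l := Simplex.eq_permute_iff.1 hux.symm l
    exact hx (fun h => hl (hul ▸ h)) hl hul

theorem semiconjBy_relabel_walk (hvi : v i = j) (hvj : v j = i) :
    SemiconjBy (relabel v) (T.walk i j)⁻¹ (T.walk i j) := by
  have hcomm : v * Equiv.swap i j = Equiv.swap i j * v := by
    rw [Equiv.mul_swap_eq_swap_mul, hvi, hvj, Equiv.swap_comm]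
  have hflip : T.walk i j * relabel v * T.walk i j = relabel v := by
    ext1 f
    simp only [Equiv.Perm.mul_apply, walk_apply, cross_relabel, relabel_relabel, hvi,
      Equiv.swap_apply_right, cross_cross]
    rw [mul_assoc, hcomm, ← mul_assoc, Equiv.swap_mul_self, one_mul]
  rw [SemiconjBy, mul_inv_eq_iff_eq_mul, hflip]

theorem walk_zpow_ne_relabel (hij : i ≠ j) (hvi : v i = j) (hvj : v j = i) (e : ℤ) :
    (T.walk i j ^ e) f ≠ relabel v f := by
  intro h
  have hflip : ∀ m d : ℤ, d + m = e →
      (T.walk i j ^ d) f = relabel v ((T.walk i j ^ m) f) := fun m d hd => by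
    have hm := (semiconjBy_relabel_walk (T := T) hvi hvj).zpow_right (-m)
    rw [inv_zpow', neg_neg] at hm
    have hmf := Equiv.congr_fun hm.eq f
    rw [Equiv.Perm.mul_apply _ (relabel v), ← h, ← Equiv.Perm.mul_apply, ← zpow_add, ← hd,
      neg_add_cancel_comm_assoc] at hmf
    exact hmf.symm
  rcases Int.even_or_odd' e with ⟨m, rfl | rfl⟩
  · have hv := relabel_eq_self_iff.1 (hflip m m (two_mul m).symm).symm
    exact hij (by rw [← hvi, hv, Equiv.Perm.one_apply])
  · have hwalk := hflip m (1 + m) (by ring)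
    rw [zpow_add, zpow_one, Equiv.Perm.mul_apply, walk_apply] at hwalk
    refine cross_ne_relabel (u := v * Equiv.swap i j) (by simp [hvj]) _
      ((relabel (Equiv.swap i j)).injective (hwalk.trans ?_))
    rw [relabel_relabel, mul_assoc, Equiv.swap_mul_self, mul_one]

/-- The walk never reverses itself, so `v` fixes `i` and `j`, and orientations exclude the one
transposition of the at most two other corners. -/
theorem eq_one_of_walk_zpow_eq_relabel_of_le_three (hn : n ≤ 3) (hij : i ≠ j) {e : ℤ}
    (he : (T.walk i j ^ e) f = relabel v f) (hv : v ⁻¹' {i, j} = {i, j}) : v = 1 := by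
  have hvij : ∀ l ∈ ({i, j} : Set (Fin (n + 1))), v l = l := by
    have hmem : ∀ l ∈ ({i, j} : Set (Fin (n + 1))), v l = i ∨ v l = j := fun l hl => hv.ge hl
    have hinj := v.injective.ne hij
    rcases hmem i (by simp) with hvi | hvi <;> rcases hmem j (by simp) with hvj | hvj
    · exact absurd (hvi.trans hvj.symm) hinj
    · rintro l (rfl | rfl) <;> assumption
    · exact absurd he (walk_zpow_ne_relabel hij hvi hvj e)
    · exact absurd (hvi.trans hvj.symm) hinj
  have hsign := frameSign_walk_zpow (T := T) hij e f
  rw [he, frameSign_relabel, mul_eq_right] at hsign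
  by_contra hv1
  obtain ⟨a, b, hab, -, rfl⟩ := exists_eq_swap_of_ncard_le_two (Z := {i, j}ᶜ)
    (by rw [Set.ncard_compl, Set.ncard_pair hij, Nat.card_fin]; omega)
    (fun l hl => hvij l (not_not.1 hl)) hv1
  rw [Equiv.Perm.sign_swap hab] at hsign
  exact absurd hsign (by decide)

theorem isFree_point_of_le_three (hn : n ≤ 3) (hij : i ≠ j) (hz : zeros x = {i, j}) :
    T.IsFree (T.point f x) := by
  refine isFree_point_of_forall_apply_eq_self fun u hu hux l hl => ?_
  obtain ⟨e, he⟩ := linked_pair_iff.1 (hz ▸ hu)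
  have hss : Equiv.swap i j ^ e * Equiv.swap i j ^ e = 1 := by
    rw [← (Commute.refl _).mul_zpow, Equiv.swap_mul_self, one_zpow]
  obtain ⟨v, rfl⟩ : ∃ v, u = v * Equiv.swap i j ^ e :=
    ⟨u * Equiv.swap i j ^ e, by rw [mul_assoc, hss, mul_one]⟩
  have hwalk : (T.walk i j ^ e) f = relabel v f := by
    rw [gallery, ← relabel_relabel] at he
    exact ((relabel _).injective he).symm
  have hsx : x.permute (Equiv.swap i j ^ e) = x := by
    rw [swap_zpow]
    split_ifs
    · rfl
    · exact Simplex.permute_swap_of_zeros_eq hz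
  rw [Simplex.permute_mul, hsx] at hux
  obtain rfl := eq_one_of_walk_zpow_eq_relabel_of_le_three hn hij hwalk
    (hz ▸ Simplex.preimage_zeros_of_permute_eq hux)
  have hlij : l ≠ i ∧ l ≠ j := by
    rw [← not_or]
    exact fun h => hl (hz.symm ▸ h : l ∈ zeros x)
  rw [one_mul, swap_zpow]
  split_ifs
  · rfl
  · exact Equiv.swap_apply_of_ne_of_ne hlij.1 hlij.2

end Triangulation

/-! ### Local injectivity -/

namespace Triangulation

variable {S : Type*} {T : Triangulation n S} {f : Frame n S} {x : Simplex n}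
  {ν : DiscType n k} {W : Set (Simplex n)} {Z : Set (Fin (n + 1))}

variable (T) in
/-- The points with label coordinates in `W` on the discs of type `ν` of all frames that are linked
to `f` by `Z`: the discs of these frames fit together to a neighbourhood in the hypersurface. -/
def patch (f : Frame n S) (ν : DiscType n k) (W : Set (Simplex n)) (Z : Set (Fin (n + 1))) :
    Set (T.Discs k) :=
  {b | ∃ g, T.Linked Z f g ∧ b.1 = (g.1, ν.map g.2) ∧ b.2.1.permute g.2⁻¹ ∈ W}

theorem mem_patch_iff {b : T.Discs k} :
    b ∈ T.patch f ν W Z ↔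
      ∃ g, T.Linked Z f g ∧ ∃ y ∈ W, ∃ hy : y ∈ disc ν, b = T.discPoint hy g := by
  refine exists_congr fun g => and_congr_right fun _ => ⟨?_, ?_⟩
  · obtain ⟨p, z, hz⟩ := b
    rintro ⟨rfl, hW⟩
    have hdisc := permute_mem_disc hz g.2⁻¹
    rw [← DiscType.map_mul, inv_mul_cancel, DiscType.map_one] at hdisc
    refine ⟨_, hW, hdisc, discs_ext rfl ?_⟩
    simpa [discPoint] using (Simplex.permute_inv_permute g.2⁻¹ z).symm
  · rintro ⟨y, hy, hyν, rfl⟩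
    exact ⟨rfl, by simpa [discPoint] using hy⟩

theorem isOpen_patch (hW : IsOpen W) : IsOpen (T.patch f ν W Z) := by
  refine isOpen_sigma_iff.2 fun p => ?_
  change IsOpen {z : disc p.2 | ∃ g, T.Linked Z f g ∧ p = (g.1, ν.map g.2) ∧ z.1.permute g.2⁻¹ ∈ W}
  simp only [Set.ofPred_exists]
  exact isOpen_iUnion fun g => isOpen_const.and <| isOpen_const.and <|
    hW.preimage ((Simplex.continuous_permute _).comp continuous_subtype_val)

theorem discProj_image_patch_mem_nhds (hW : IsOpen W) (hxW : x ∈ W) (hx : x ∈ disc ν)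
    (hZ : ∀ y ∈ W, zeros y ⊆ Z) :
    T.discProj '' T.patch f ν W Z ∈ 𝓝 (T.discProj (T.discPoint hx f)) := by
  have hglue : ∀ a b, T.DiscGlue k a b → a ∈ T.patch f ν W Z → b ∈ T.patch f ν W Z := by
    intro a b hab ha
    obtain ⟨g, hg, y, hyW, hy, rfl⟩ := mem_patch_iff.1 ha
    obtain ⟨c, hc, rfl⟩ := discGlue_discPoint_iff.1 hab
    exact mem_patch_iff.2 ⟨_, hg.tail ⟨c, hZ y hyW hc, rfl⟩, y, hyW, hy, rfl⟩
  have hsat : T.discProj ⁻¹' (T.discProj '' T.patch f ν W Z) = T.patch f ν W Z := by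
    refine Set.Subset.antisymm ?_ (Set.subset_preimage_image _ _)
    rintro b ⟨a, ha, hab⟩
    exact eq_of_quot_mk_eq discGlue_symm hglue hab ha
  refine IsOpen.mem_nhds ?_ ⟨_, mem_patch_iff.2 ⟨f, .refl, x, hxW, hx, rfl⟩, rfl⟩
  exact isQuotientMap_discProj.isOpen_preimage.1 (hsat.symm ▸ isOpen_patch hW)

theorem HasTrivialHolonomy.hypersurfaceIsImmersion (hT : T.HasTrivialHolonomy) (k : ℕ) :
    T.HypersurfaceIsImmersion k := by
  intro h hreg
  obtain ⟨a, rfl⟩ := isQuotientMap_discProj.surjective h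
  obtain ⟨ν, x, hx, f, rfl⟩ : ∃ (ν : DiscType n k) (x : Simplex n) (hx : x ∈ disc ν) (f : _),
      a = T.discPoint hx f := ⟨_, _, _, _, (discPoint_one a).symm⟩
  obtain ⟨W, hW, hxW, hZ, hWx⟩ := x.exists_isOpen_permute
  refine ⟨_, discProj_image_patch_mem_nhds hW hxW hx hZ, ?_⟩
  rintro _ ⟨_, ha, rfl⟩ _ ⟨_, hb, rfl⟩ hab
  obtain ⟨g, hg, y, hyW, hy, rfl⟩ := mem_patch_iff.1 ha
  obtain ⟨h, hh, z, hzW, hz, rfl⟩ := mem_patch_iff.1 hb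
  change T.proj (T.point g y) = T.proj (T.point h z) at hab
  obtain ⟨u, hu, rfl⟩ := proj_point_eq_proj_point_iff.1 hab
  have hux := hWx u y hyW hzW
  have hfu : T.Linked (zeros x) f (relabel u f) := by
    have hfh := hh.map_relabel u
    rw [Simplex.preimage_zeros_of_permute_eq hux] at hfh
    exact (hg.trans (hu.mono (hZ y hyW))).trans hfh.symm
  obtain rfl := hT f x hreg u hfu hux
  exact discProj_discPoint_eq_iff.2 ⟨h, hu, rfl⟩

end Triangulation

/-! ### Branching -/

/-- The disc type that separates the corners in `A` from the others. -/
def DiscType.of (A : Finset (Fin (n + 1))) (hA : A.card = k) : DiscType n k :=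
  ⟨s(A, Aᶜ), A, hA, rfl⟩

theorem mem_disc_of_iff {A : Finset (Fin (n + 1))} (hA : A.card = k) {x : Simplex n} :
    x ∈ disc (DiscType.of A hA) ↔ ∑ l ∈ A, x l = 1 / 2 := by
  rw [mem_disc_iff]
  refine ⟨fun h => h A (Sym2.mem_mk_left _ _), fun h B hB => ?_⟩
  rcases Sym2.mem_iff.1 hB with rfl | rfl
  · exact h
  · have hsum : ∑ l ∈ A, x l + ∑ l ∈ Aᶜ, x l = 1 := by
      rw [Finset.sum_add_sum_compl, stdSimplex.sum_eq_one]
    linarith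

theorem DiscType.map_swap_of_ne {A : Finset (Fin (n + 1))} (hA : A.card = k) (hi : i ∈ A)
    (hj : j ∉ A) (hp : p ∈ A) (hpi : p ≠ i) :
    (DiscType.of A hA).map (Equiv.swap i j) ≠ DiscType.of A hA := by
  intro h
  have hmem : A.map (Equiv.swap i j).toEmbedding ∈ (DiscType.of A hA).1 :=
    h ▸ Sym2.mem_mk_left _ _
  have hpj : p ≠ j := fun h => hj (h ▸ hp)
  rcases Sym2.mem_iff.1 hmem with hmap | hmap
  · have : j ∈ A.map (Equiv.swap i j).toEmbedding := by simpa [Finset.mem_map_equiv] using hi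
    exact hj (hmap ▸ this)
  · have : p ∈ A.map (Equiv.swap i j).toEmbedding := by
      simpa [Finset.mem_map_equiv, Equiv.swap_apply_of_ne_of_ne hpi hpj] using hp
    exact Finset.mem_compl.1 (hmap ▸ this) hp

theorem exists_separating_finset (hk : 1 < k) (hkn : k < n) (hij : i ≠ j) :
    ∃ A : Finset (Fin (n + 1)), A.card = k ∧ i ∈ A ∧ j ∉ A ∧ (∃ p ∈ A, p ≠ i) ∧ ∃ q ∉ A, q ≠ j := by
  obtain ⟨A, hiA, hAj, hA⟩ := Finset.exists_subsuperset_card_eq (s := {i}) (t := {j}ᶜ) (n := k)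
    (by simpa using hij.symm) (by simpa using hk.le)
    (by rw [Finset.card_compl, Finset.card_singleton, Fintype.card_fin]; omega)
  have hj : j ∉ A := fun h => by simpa using hAj h
  obtain ⟨q, hq, hqj⟩ := Finset.exists_mem_ne (s := Aᶜ)
    (by rw [Finset.card_compl, Fintype.card_fin]; omega) j
  exact ⟨A, hA, by simpa using hiA, hj, Finset.exists_mem_ne (hA ▸ hk) i, q,
    Finset.mem_compl.1 hq, hqj⟩

theorem exists_mem_nhds_mem_disc {A : Finset (Fin (n + 1))} {hA : A.card = k} (hi : i ∈ A)
    (hj : j ∉ A) (hp : p ∈ A) (hpi : p ≠ i) (hq : q ∉ A) (hqj : q ≠ j) {x : Simplex n}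
    (hz : zeros x = {i, j}) (hx : x ∈ disc (DiscType.of A hA)) {N : Set (Simplex n)}
    (hN : N ∈ 𝓝 x) :
    ∃ y ∈ N, y ∈ disc (DiscType.of A hA) ∧ zeros y = ∅ ∧ y i = y j := by
  have hij : i ≠ j := fun h => hj (h ▸ hi)
  have hpj : p ≠ j := fun h => hj (h ▸ hp)
  have hqi : q ≠ i := fun h => hq (h ▸ hi)
  let v : Fin (n + 1) → ℝ := Pi.single i 1 + Pi.single j 1 - Pi.single p 1 - Pi.single q 1
  have hvi : v i = 1 := by simp [v, hij, hpi.symm, hqi.symm]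
  have hvj : v j = 1 := by simp [v, hij.symm, hpj.symm, hqj.symm]
  have hvz : ∀ l ∈ zeros x, v l = 1 := by
    rw [hz]
    rintro l (rfl | rfl) <;> assumption
  obtain ⟨y, hyN, ⟨t, -, hyt⟩, hzy⟩ := Simplex.exists_mem_nhds_add_mul hN (v := v)
    (by simp [v, Finset.sum_add_distrib]) fun l hl => (hvz l hl).ge.trans' zero_le_one
  refine ⟨y, hyN, ?_, ?_, ?_⟩
  · rw [mem_disc_of_iff] at hx ⊢
    simp only [hyt, Finset.sum_add_distrib, hx, ← Finset.mul_sum]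
    simp [v, Finset.sum_add_distrib, hi, hj, hp, hq]
  · rw [hzy, Set.sep_eq_empty_iff_mem_false]
    exact fun l hl => by simp [hvz l hl]
  · rw [hyt, hyt, hvi, hvj, mem_zeros.1 (by simp [hz] : i ∈ zeros x),
      mem_zeros.1 (by simp [hz] : j ∈ zeros x)]

namespace Triangulation

variable {S : Type*} {T : Triangulation n S} {f : Frame n S} {x : Simplex n}
  {ν : DiscType n k}

theorem continuous_discProj_discPoint (f : Frame n S) :
    Continuous fun x : disc ν => T.discProj (T.discPoint x.2 f) :=
  isQuotientMap_discProj.continuous.comp <| continuous_sigmaMk.comp <|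
    ((Simplex.continuous_permute f.2).comp continuous_subtype_val).subtype_mk _

theorem exists_mem_nhds_forall_discProj_mem (hx : x ∈ disc ν) {U : Set (T.Hypersurface k)}
    (hU : U ∈ 𝓝 (T.discProj (T.discPoint hx f))) :
    ∃ N ∈ 𝓝 x, ∀ y ∈ N, ∀ hy : y ∈ disc ν, T.discProj (T.discPoint hy f) ∈ U := by
  have hcont := (continuous_discProj_discPoint (T := T) (ν := ν) f).continuousAt (x := ⟨x, hx⟩)
  obtain ⟨N, hN, hNU⟩ := mem_nhds_subtype _ _ _ |>.1 (hcont hU)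
  exact ⟨N, hN, fun y hyN hy => hNU (a := ⟨y, hy⟩) hyN⟩

theorem isRegular_proj_point_of_injOn (hn : 3 ≤ n) (hij : i ≠ j) (hz : zeros x = {i, j})
    (hx : n ≤ 3 ∨ Set.InjOn x (zeros x)ᶜ) : T.IsRegular (T.proj (T.point f x)) := by
  refine (isRegular_proj_iff hn).2
    ⟨?_, hx.elim (isFree_point_of_le_three · hij hz) isFree_point_of_injOn⟩
  rw [point, ncard_zeros_permute, hz, Set.ncard_pair hij]

theorem HypersurfaceIsImmersion.not_linked_swap (hT : T.HypersurfaceIsImmersion k) (hk : 1 < k)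
    (hkn : k < n) (hij : i ≠ j) (f : Frame n S) :
    ¬ T.Linked {i, j} f (relabel (Equiv.swap i j) f) := by
  intro hf
  obtain ⟨A, hA, hi, hj, ⟨p, hp, hpi⟩, q, hq, hqj⟩ := exists_separating_finset hk hkn hij
  obtain ⟨x, hz, hxA, hinj⟩ := exists_zeros_eq_pair_injOn hi hj hp hpi hq hqj
  rw [← mem_disc_of_iff hA] at hxA
  have hreg : T.IsRegular (T.proj (T.point f x)) :=
    isRegular_proj_point_of_injOn (by omega) hij hz hinj
  obtain ⟨U, hU, hinjU⟩ := hT (T.discProj (T.discPoint hxA f)) hreg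
  have hU' : U ∈ 𝓝 (T.discProj (T.discPoint hxA (relabel (Equiv.swap i j) f))) := by
    rwa [← discProj_discPoint_eq_iff.2 ⟨_, hz ▸ hf, rfl⟩]
  obtain ⟨N, hN, hNU⟩ := exists_mem_nhds_forall_discProj_mem hxA hU
  obtain ⟨N', hN', hNU'⟩ := exists_mem_nhds_forall_discProj_mem hxA hU'
  obtain ⟨y, ⟨hyN, hyN'⟩, hyA, hy, hyij⟩ :=
    exists_mem_nhds_mem_disc hi hj hp hpi hq hqj hz hxA (Filter.inter_mem hN hN')
  have hproj : T.proj (T.point f y) = T.proj (T.point (relabel (Equiv.swap i j) f) y) := by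
    rw [point_relabel, Simplex.permute_swap_of_eq hyij]
  obtain ⟨g, hg, hdisc⟩ :=
    discProj_discPoint_eq_iff.1 (hinjU (hNU y hyN hyA) (hNU' y hyN' hyA) hproj)
  rw [hy, linked_empty_iff] at hg
  subst hg
  have hmap : (DiscType.of A hA).map (f.2 * Equiv.swap i j) = (DiscType.of A hA).map f.2 :=
    congrArg (fun b => b.1.2) hdisc
  rw [DiscType.map_mul, (DiscType.map_injective f.2).eq_iff] at hmap
  exact DiscType.map_swap_of_ne hA hi hj hp hpi hmap

theorem HypersurfaceIsImmersion.hasTrivialHolonomy (hT : T.HypersurfaceIsImmersion k) (hk : 1 < k)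
    (hkn : k < n) : T.HasTrivialHolonomy := by
  intro f x hreg u hu hux
  by_contra hu1
  obtain ⟨hcard, hfree⟩ := (isRegular_proj_iff (by omega)).1 hreg
  obtain ⟨i, j, hij, hz, rfl⟩ := exists_eq_swap_of_ncard_le_two
    (show (zeros x).ncard ≤ 2 by simpa [point, ncard_zeros_permute] using hcard)
    (fun l hl => hfree.apply_eq_self hu hux hl) hu1
  exact hT.not_linked_swap hk hkn hij f (hz ▸ hu)

end Triangulation

end PseudoManifold

theorem mainTheorem9_general (n k : ℕ) (hk : 1 < k) (hkn : k < n) {S : Type*}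
    (T : PseudoManifold.Triangulation n S) : T.HypersurfaceIsImmersion k ↔ T.FiniteDegreesEven :=
  Iff.trans ⟨fun h => h.hasTrivialHolonomy hk hkn, fun h => h.hypersurfaceIsImmersion k⟩
    (PseudoManifold.Triangulation.hasTrivialHolonomy_iff_finiteDegreesEven (by omega))

theorem mainTheorem9 (n : ℕ) (hn : 3 ≤ n) (k : ℕ) (hk : 1 < k) (hkn : 2 * k ≤ n + 1)
    {S : Type*} [Finite S] (T : PseudoManifold.Triangulation n S) :
    T.HypersurfaceIsImmersion k ↔ T.IsEven :=
  (mainTheorem9_general n k hk (by omega) T).trans T.finiteDegreesEven_iff_isEven
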